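/- Let $M$ be a von Neumann algebra with a normal tracial state $\varphi$, let $n\ge 1$, and let $z_1,\dots,z_n\in M$ be selfadjoint. Notation. For $k\ge1$ let $tr_k$ be the normalized trace on $k\times k$ complex matrices, and let $(M_k^{sa}(\mathbb C))^n$ be the space of $n$-tuples of selfadjoint $k\times k$ complex matrices, with the norm $|(x_1,\dots,x_n)|_2=\big(\sum_{i} tr_k(x_i^2)\big)^{1/2}$. Let $\mathrm{vol}$ be Lebesgue measure on it with respect to the inner product of the norm $\|(x_1,\dots,x_n)\|_2=\big(k\sum_i tr_k(x_i^2)\big)^{1/2}$. For $R,\gamma>0$ and $m\in\mathbb N$ let $\Gamma_R(z_1,\dots,z_n;m,k,\gamma)$ be the set of $(x_1,\dots,x_n)\in(M_k^{sa}(\mathbb C))^n$ with operator norms $\|x_i\|\le R$ for all $i$ and $$|tr_k(x_{i_1}\cdots x_{i_p})-\varphi(z_{i_1}\cdots z_{i_p})|<\gamma\qquad(1\le p\le m,\ 1\le i_1,\dots,i_p\le n).$$ For a subset $S$ of a metric space and $r,\epsilon>0$ let $H^r_\epsilon(S)$ be the infimum of $\sum_{j}|\theta_j|^r$ over all countable covers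 $(\theta_j)$ of $S$ by sets of diameter $|\theta_j|\le\epsilon$. With $\log 0=-\infty$ and values in $[-\infty,\infty]$, define Voiculescu's free entropy $$\chi(z_1,\dots,z_n)=\sup_{R>0}\ \inf_{m\in\mathbb N,\,\gamma>0}\ \limsup_{k\to\infty}\Big(k^{-2}\log \mathrm{vol}\big(\Gamma_R(z_1,\dots,z_n;m,k,\gamma)\big)+\tfrac n2\log k\Big)$$ and, for $r>0$, the free Hausdorff $r$-entropy $$\mathbb H^r(z_1,\dots,z_n)=\sup_{R>0}\ \lim_{\epsilon\to0^+}\ \inf_{m\in\mathbb N,\,\gamma>0}\ \limsup_{k\to\infty}\ k^{-2}\log H^{rk^2}_\epsilon\big(\Gamma_R(z_1,\dots,z_n;m,k,\gamma)\big),$$ where $H^{rk^2}_\epsilon$ is taken in the metric of $|\cdot|_2$ (the limit exists by monotonicity in $\epsilon$). Lemma. In $[-\infty,\infty]$, $$\mathbb H^n(z_1,\dots,z_n)=\chi(z_1,\dots,z_n)+\frac n2\log\Big(\frac{2n}{\pi e}\Big).$$ -/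

import Mathlib

open Filter Topology MeasureTheory
open scoped ENNReal ComplexOrder

noncomputable section

namespace FreeHausdorff

/-! ### Tracial von Neumann algebras -/

/-- `φ` is a normal tracial state on the von Neumann algebra `M`: a unital positive linear functional
with `φ (x y) = φ (y x)` which respects suprema (in the operator order) of bounded increasing
nets of self-adjoint elements. -/
structure IsNormalTracialState {H : Type*} [NormedAddCommGroup H] [InnerProductSpace ℂ H]
    [CompleteSpace H] (M : VonNeumannAlgebra H) (φ : M.toStarSubalgebra →ₗ[ℂ] ℂ) : Prop where
  map_one : φ 1 = 1
  nonneg : ∀ x, 0 ≤ φ (star x * x)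
  tracial : ∀ x y, φ (x * y) = φ (y * x)
  normal : ∀ (D : Set M.toStarSubalgebra) (x : M.toStarSubalgebra), D.Nonempty →
    (∀ a ∈ D, IsSelfAdjoint a) →
    DirectedOn (fun a b : M.toStarSubalgebra => (a : H →L[ℂ] H) ≤ (b : H →L[ℂ] H)) D →
    IsLUB ((fun a : M.toStarSubalgebra => (a : H →L[ℂ] H)) '' D) (x : H →L[ℂ] H) →
    IsLUB ((fun a => (φ a).re) '' D) (φ x).re

/-! ### Tuples of self-adjoint matrices -/

/-- The normalized trace on `k × k` complex matrices. -/
def ntr (k : ℕ) (A : Matrix (Fin k) (Fin k) ℂ) : ℂ := (k : ℂ)⁻¹ * A.trace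

/-- The real vector space of `n`-tuples of self-adjoint `k × k` complex matrices. -/
def SATuple (n k : ℕ) : Type := Fin n → selfAdjoint (Matrix (Fin k) (Fin k) ℂ)

namespace SATuple

variable {n k : ℕ}

instance : AddCommGroup (SATuple n k) :=
  inferInstanceAs (AddCommGroup (Fin n → selfAdjoint (Matrix (Fin k) (Fin k) ℂ)))

instance : Module ℝ (SATuple n k) :=
  inferInstanceAs (Module ℝ (Fin n → selfAdjoint (Matrix (Fin k) (Fin k) ℂ)))

instance : FiniteDimensional ℝ (SATuple n k) :=
  haveI : FiniteDimensional ℝ (selfAdjoint (Matrix (Fin k) (Fin k) ℂ)) :=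
    inferInstanceAs
      (FiniteDimensional ℝ (selfAdjoint.submodule ℝ (Matrix (Fin k) (Fin k) ℂ)))
  inferInstanceAs (FiniteDimensional ℝ (Fin n → selfAdjoint (Matrix (Fin k) (Fin k) ℂ)))

/-- The `i`-th matrix of the tuple. -/
def mat (x : SATuple n k) (i : Fin n) : Matrix (Fin k) (Fin k) ℂ := (x i).1

lemma isHermitian_mat (x : SATuple n k) (i : Fin n) : (x.mat i).IsHermitian := (x i).2

@[simp] lemma mat_add (x y : SATuple n k) (i : Fin n) : (x + y).mat i = x.mat i + y.mat i := rfl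

@[simp] lemma mat_sub (x y : SATuple n k) (i : Fin n) : (x - y).mat i = x.mat i - y.mat i := rfl

@[simp] lemma mat_smul (c : ℝ) (x : SATuple n k) (i : Fin n) : (c • x).mat i = c • x.mat i := rfl

lemma trace_mul_self_eq (x : SATuple n k) (i : Fin n) :
    (x.mat i * x.mat i).trace.re = ∑ a, ∑ b, ‖x.mat i a b‖ ^ 2 := by
  simp only [Matrix.trace, Matrix.diag_apply, Matrix.mul_apply, Complex.re_sum]
  refine Finset.sum_congr rfl fun a _ => Finset.sum_congr rfl fun b _ => ?_
  rw [← (x.isHermitian_mat i).apply b a, Complex.star_def, Complex.mul_conj,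
    Complex.normSq_eq_norm_sq, Complex.ofReal_re]

/-- The inner product `⟨x, y⟩ = ∑ i, Tr (x i * y i)` (with the unnormalized trace `Tr`; the sum
is real). -/
abbrev innerCore (n k : ℕ) : InnerProductSpace.Core ℝ (SATuple n k) where
  inner x y := ∑ i, (x.mat i * y.mat i).trace.re
  conj_inner_symm x y := by
    simp only [conj_trivial]
    exact Finset.sum_congr rfl fun i _ => by rw [Matrix.trace_mul_comm]
  re_inner_nonneg x := by
    simp only [RCLike.re_to_real, trace_mul_self_eq]
    positivity
  add_left x y z := by
    simp [add_mul, Finset.sum_add_distrib]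
  smul_left x y c := by
    simp [Finset.mul_sum]
  definite x h := by
    simp only [trace_mul_self_eq] at h
    rw [Finset.sum_eq_zero_iff_of_nonneg (fun _ _ => by positivity)] at h
    funext i
    apply Subtype.ext
    ext a b
    have h1 := h i (Finset.mem_univ _)
    rw [Finset.sum_eq_zero_iff_of_nonneg (fun _ _ => by positivity)] at h1
    have h2 := h1 a (Finset.mem_univ _)
    rw [Finset.sum_eq_zero_iff_of_nonneg (fun _ _ => by positivity)] at h2
    exact norm_eq_zero.mp (pow_eq_zero_iff two_ne_zero |>.mp (h2 b (Finset.mem_univ _)))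

instance : NormedAddCommGroup (SATuple n k) := (innerCore n k).toNormedAddCommGroup

/-- The Euclidean structure whose norm is
`‖x‖ = (∑ i, Tr (x i ^ 2)) ^ (1/2) = (k * ∑ i, ntr k (x i ^ 2)) ^ (1/2)`. Mathlib's `volume` is then
the Lebesgue measure of this inner product. -/
instance : InnerProductSpace ℝ (SATuple n k) := InnerProductSpace.ofCore (innerCore n k).toCore

instance : MeasurableSpace (SATuple n k) := borel _

instance : BorelSpace (SATuple n k) := ⟨rfl⟩

/-- The normalized norm `|x|₂ = (∑ i, ntr k (x i ^ 2)) ^ (1/2)`. -/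
def norm₂ (x : SATuple n k) : ℝ := √(∑ i, (ntr k (x.mat i ^ 2)).re)

/-- The metric on tuples induced by `|·|₂`. -/
def dist₂ (x y : SATuple n k) : ℝ := (x - y).norm₂

lemma norm_eq (x : SATuple n k) : ‖x‖ = √(∑ i, (x.mat i ^ 2).trace.re) := by
  simp only [pow_two]
  rfl

lemma norm₂_eq (x : SATuple n k) : x.norm₂ = ‖x‖ / √k := by
  rw [norm_eq, norm₂, ← Real.sqrt_div' _ (Nat.cast_nonneg k), Finset.sum_div]
  congr 1
  refine Finset.sum_congr rfl fun i _ => ?_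
  rw [ntr, ← Complex.ofReal_natCast, ← Complex.ofReal_inv, Complex.re_ofReal_mul]
  ring

end SATuple

/-! ### Hausdorff premeasures -/

/-- The diameter of a set with respect to a distance function `d` (zero for the empty set). -/
def diamWith {X : Type*} (d : X → X → ℝ) (θ : Set X) : ℝ≥0∞ :=
  ⨆ x ∈ θ, ⨆ y ∈ θ, ENNReal.ofReal (d x y)

/-- `H^r_ε(S)`, for `r > 0`: the infimum of `∑ j, |θ j| ^ r` over all countable `ε`-covers of `S`,
that is, over all sequences of sets of diameter at most `ε` covering `S` (a finite cover is
padded with empty sets, which have diameter zero). -/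
def hausdorffPre {X : Type*} (d : X → X → ℝ) (r ε : ℝ) (S : Set X) : ℝ≥0∞ :=
  ⨅ (θ : ℕ → Set X) (_ : S ⊆ ⋃ j, θ j) (_ : ∀ j, diamWith d (θ j) ≤ ENNReal.ofReal ε),
    ∑' j, diamWith d (θ j) ^ r

lemma hausdorffPre_anti {X : Type*} (d : X → X → ℝ) (r : ℝ) (S : Set X) {ε₁ ε₂ : ℝ}
    (h : ε₁ ≤ ε₂) : hausdorffPre d r ε₂ S ≤ hausdorffPre d r ε₁ S :=
  le_iInf fun θ => le_iInf fun hc => le_iInf fun hd =>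
    iInf_le_of_le θ (iInf_le_of_le hc (iInf_le_of_le
      (fun j => (hd j).trans (ENNReal.ofReal_le_ofReal h)) le_rfl))

/-! ### Microstates, free entropy and free Hausdorff entropy

The quantities below depend on `z₁, …, zₙ` only through the joint moments with respect to `φ`. -/

section

variable {A : Type*} [Ring A] [Algebra ℂ A] {n : ℕ}

/-- The matricial microstate space `Γ_R(z₁, …, zₙ; m, k, γ)`: the `n`-tuples of self-adjoint `k × k`
matrices of operator norm at most `R` whose moments of orders `1, …, m` are within `γ` of those of
`(z₁, …, zₙ)`. -/
def microstates (φ : A →ₗ[ℂ] ℂ) (z : Fin n → A) (R : ℝ) (m k : ℕ) (γ : ℝ) :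
    Set (SATuple n k) :=
  {x | (∀ i, ‖Matrix.toEuclideanCLM (𝕜 := ℂ) (x.mat i)‖ ≤ R) ∧
    ∀ w : List (Fin n), 1 ≤ w.length → w.length ≤ m →
      ‖ntr k (w.map x.mat).prod - φ (w.map z).prod‖ < γ}

/-- `χ_R(z₁, …, zₙ; m, γ) = limsup_k (k⁻² log vol Γ_R(z₁, …, zₙ; m, k, γ) + (n/2) log k)`. -/
def chiRmγ (φ : A →ₗ[ℂ] ℂ) (z : Fin n → A) (R : ℝ) (m : ℕ) (γ : ℝ) : EReal :=
  limsup (fun k : ℕ =>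
    ((((k : ℝ) ^ 2)⁻¹ : ℝ) : EReal) * ENNReal.log (volume (microstates φ z R m k γ)) +
      (((n : ℝ) / 2 * Real.log k : ℝ) : EReal)) atTop

/-- `χ_R(z₁, …, zₙ)`, the infimum of `χ_R(z₁, …, zₙ; m, γ)` over all `m ∈ ℕ` and `γ > 0`. -/
def chiR (φ : A →ₗ[ℂ] ℂ) (z : Fin n → A) (R : ℝ) : EReal :=
  ⨅ (m : ℕ) (γ : ℝ) (_ : 0 < γ), chiRmγ φ z R m γ

/-- Voiculescu's free entropy `χ(z₁, …, zₙ) = sup_{R > 0} χ_R(z₁, …, zₙ)`. -/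
def chi (φ : A →ₗ[ℂ] ℂ) (z : Fin n → A) : EReal :=
  ⨆ (R : ℝ) (_ : 0 < R), chiR φ z R

/-- `ℍ^r_{ε,R}(z₁, …, zₙ; m, γ) = limsup_k k⁻² log H^{r k²}_ε(Γ_R(z₁, …, zₙ; m, k, γ))`, where the
Hausdorff quantity is taken in the metric `|·|₂`. -/
def hausEntεRmγ (φ : A →ₗ[ℂ] ℂ) (z : Fin n → A) (r ε R : ℝ) (m : ℕ) (γ : ℝ) : EReal :=
  limsup (fun k : ℕ =>
    ((((k : ℝ) ^ 2)⁻¹ : ℝ) : EReal) *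
      ENNReal.log (hausdorffPre SATuple.dist₂ (r * (k : ℝ) ^ 2) ε (microstates φ z R m k γ)))
    atTop

/-- `ℍ^r_{ε,R}(z₁, …, zₙ)`, the infimum over all `m ∈ ℕ` and `γ > 0`. -/
def hausEntεR (φ : A →ₗ[ℂ] ℂ) (z : Fin n → A) (r ε R : ℝ) : EReal :=
  ⨅ (m : ℕ) (γ : ℝ) (_ : 0 < γ), hausEntεRmγ φ z r ε R m γ

/-- `ℍ^r_R(z₁, …, zₙ) = lim_{ε → 0+} ℍ^r_{ε,R}(z₁, …, zₙ)`; the limit exists, see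
`tendsto_hausEntεR`. -/
def hausEntR (φ : A →ₗ[ℂ] ℂ) (z : Fin n → A) (r R : ℝ) : EReal :=
  limUnder (𝓝[>] (0 : ℝ)) fun ε => hausEntεR φ z r ε R

/-- The free Hausdorff `r`-entropy `ℍ^r(z₁, …, zₙ) = sup_{R > 0} ℍ^r_R(z₁, …, zₙ)`. -/
def hausEnt (φ : A →ₗ[ℂ] ℂ) (z : Fin n → A) (r : ℝ) : EReal :=
  ⨆ (R : ℝ) (_ : 0 < R), hausEntR φ z r R

lemma hausEntεR_anti (φ : A →ₗ[ℂ] ℂ) (z : Fin n → A) (r R : ℝ) :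
    Antitone fun ε => hausEntεR φ z r ε R := by
  intro ε₁ ε₂ h
  refine iInf_mono fun m => iInf_mono fun γ => iInf_mono fun _ => ?_
  refine limsup_le_limsup (Eventually.of_forall fun k => ?_)
  refine mul_le_mul_of_nonneg_left (ENNReal.log_monotone (hausdorffPre_anti _ _ _ h)) ?_
  exact_mod_cast (by positivity : (0 : ℝ) ≤ ((k : ℝ) ^ 2)⁻¹)

/-- The limit defining `hausEntR` exists, and is a supremum. -/
lemma tendsto_hausEntεR (φ : A →ₗ[ℂ] ℂ) (z : Fin n → A) (r R : ℝ) :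
    Tendsto (fun ε => hausEntεR φ z r ε R) (𝓝[>] (0 : ℝ)) (𝓝 (hausEntR φ z r R)) :=
  tendsto_nhds_limUnder ⟨_, (hausEntεR_anti φ z r R).tendsto_nhdsGT 0⟩

end

end FreeHausdorff

end

/-!
Fix `k ≥ 1` and let `N = n * k ^ 2`, the real dimension of the space of `n`-tuples of self-adjoint
`k × k` matrices. In the Hausdorff entropy of order `n` the exponent is exactly `N`, and in that top
dimension the premeasure `H^N_ε` is a multiple of Lebesgue measure for every `ε > 0`, not only in the
limit: `C * H^N_ε(S) = vol S` for every set `S`, where `C` is the volume of a Euclidean ball of radius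
`√k / 2`, that is, of a `|·|₂`-ball of diameter one (`volume_closedBall_mul_hausdorffPre`). That `vol S`
is at most the left side is the isodiametric inequality (`volume_le_volume_closedBall_of_dist_le`),
deduced here from the Prékopa–Leindler inequality at midpoints (`midpointPL_volume`), which is proved
on the line through Brunn–Minkowski for superlevel sets and then tensorized. The converse is a
Besicovitch covering by small balls.

Hence the sequences that define the two entropies differ by the real sequence
`k⁻² log C + (n / 2) log k`, which by Stirling's formula for `Γ(N / 2 + 1)` tends to
`-(n / 2) log (2 n / (π e))` (`tendsto_logBallVolume`). Adding a convergent real sequence shifts a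
limsup by its limit, and translation by a real number is an order automorphism of the extended reals,
so the shift passes through the infimum over `m, γ`, the limit in `ε` (of a constant function) and the
supremum over `R`.
-/

namespace FreeHausdorff

/-! ### The midpoint Prékopa–Leindler inequality -/

/-- The Prékopa–Leindler inequality with weight `1 / 2` for the measure `μ`, in a form free of square
roots: if `f x * g y ≤ h ((x + y) / 2) ^ 2` for all `x, y`, then `(∫ f) * (∫ g) ≤ (∫ h) ^ 2`. -/
def MidpointPL {E : Type*} [AddCommGroup E] [Module ℝ E] [MeasurableSpace E]
    (μ : Measure E) : Prop :=
  ∀ f g h : E → ℝ≥0∞, Measurable f → Measurable g → Measurable h →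
    (∀ x y, f x * g y ≤ h ((1 / 2 : ℝ) • (x + y)) ^ 2) →
    (∫⁻ x, f x ∂μ) * (∫⁻ x, g x ∂μ) ≤ (∫⁻ x, h x ∂μ) ^ 2

/-- The Brunn–Minkowski inequality on the line for compact sets `A` and `B`: the translates of `A` by
`min B` and of `B` by `max A` lie in `A + B` and overlap in one point only. -/
lemma volume_add_le_of_isCompact {A B S : Set ℝ} (hA : IsCompact A) (hB : IsCompact B)
    (hA0 : A.Nonempty) (hB0 : B.Nonempty) (hS : ∀ x ∈ A, ∀ y ∈ B, x + y ∈ S) :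
    volume A + volume B ≤ volume S := by
  obtain ⟨a, haA, ha⟩ := hA.exists_isMaxOn hA0 continuousOn_id
  obtain ⟨b, hbB, hb⟩ := hB.exists_isMinOn hB0 continuousOn_id
  have hd : AEDisjoint volume ((fun x => x + b) '' A) ((fun y => a + y) '' B) := by
    refine measure_mono_null (t := {a + b}) ?_ (measure_singleton _)
    rintro _ ⟨⟨x, hx, rfl⟩, y, hy, hxy⟩
    have h1 : x ≤ a := ha hx
    have h2 : b ≤ y := hb hy
    simp only [Set.mem_singleton_iff] at hxy ⊢
    linarith
  have hm : NullMeasurableSet ((fun y => a + y) '' B) volume :=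
    (hB.image (by fun_prop)).measurableSet.nullMeasurableSet
  have h1 : volume ((fun x => x + b) '' A) = volume A := by
    rw [Set.image_add_right, measure_preimage_add_right]
  have h2 : volume ((fun y => a + y) '' B) = volume B := by
    rw [Set.image_add_left, measure_preimage_add]
  rw [← h1, ← h2, ← measure_union₀ hm hd]
  refine measure_mono (Set.union_subset ?_ ?_)
  · rintro _ ⟨x, hx, rfl⟩
    exact hS x hx b hbB
  · rintro _ ⟨y, hy, rfl⟩
    exact hS a haA y hy

/-- The Brunn–Minkowski inequality on the line, by inner regularity. -/
lemma volume_add_le {A B S : Set ℝ} (hA : MeasurableSet A) (hB : MeasurableSet B)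
    (hA0 : A.Nonempty) (hB0 : B.Nonempty) (hS : ∀ x ∈ A, ∀ y ∈ B, x + y ∈ S) :
    volume A + volume B ≤ volume S := by
  obtain ⟨a, ha⟩ := hA0
  obtain ⟨b, hb⟩ := hB0
  rw [hA.measure_eq_iSup_isCompact, hB.measure_eq_iSup_isCompact]
  simp only [iSup_and']
  refine ENNReal.biSup_add_biSup_le' (p := fun K => K ⊆ A ∧ IsCompact K)
    (q := fun L => L ⊆ B ∧ IsCompact L) ⟨∅, Set.empty_subset _, isCompact_empty⟩
    ⟨∅, Set.empty_subset _, isCompact_empty⟩ fun K hK L hL => ?_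
  calc volume K + volume L ≤ volume (insert a K) + volume (insert b L) := by
        gcongr <;> exact Set.subset_insert _ _
    _ ≤ volume S := by
        refine volume_add_le_of_isCompact (hK.2.insert a) (hL.2.insert b) (Set.insert_nonempty _ _)
          (Set.insert_nonempty _ _) fun x hx y hy => hS x ?_ y ?_
        · exact Set.insert_subset ha hK.1 hx
        · exact Set.insert_subset hb hL.1 hy

lemma four_mul_le_add_sq (a b : ℝ≥0∞) : 4 * (a * b) ≤ (a + b) ^ 2 := by
  rcases eq_or_ne a ⊤ with rfl | ha
  · simp
  rcases eq_or_ne b ⊤ with rfl | hb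
  · simp
  lift a to NNReal using ha
  lift b to NNReal using hb
  rw [← mul_assoc]
  exact_mod_cast four_mul_le_sq_add a b

lemma lintegral_eq_lintegral_Ioo_volume_lt {f : ℝ → ℝ≥0∞} (hf : Measurable f)
    (hf1 : ∀ x, f x ≤ 1) :
    ∫⁻ x, f x = ∫⁻ t in Set.Ioo (0 : ℝ) 1, volume {x | ENNReal.ofReal t < f x} := by
  have h0 : ∀ x, f x ≠ ⊤ := fun x => ne_top_of_le_ne_top ENNReal.one_ne_top (hf1 x)
  calc ∫⁻ x, f x = ∫⁻ x, ENNReal.ofReal (f x).toReal := by simp [ENNReal.ofReal_toReal, h0]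
    _ = ∫⁻ t in Set.Ioi (0 : ℝ), volume {x | t < (f x).toReal} :=
      lintegral_eq_lintegral_meas_lt _ (Eventually.of_forall fun _ => ENNReal.toReal_nonneg)
        hf.ennreal_toReal.aemeasurable
    _ = ∫⁻ t in Set.Ioi (0 : ℝ), volume {x | ENNReal.ofReal t < f x} := by
      refine setLIntegral_congr_fun measurableSet_Ioi fun t ht => ?_
      simp only [ENNReal.ofReal_lt_iff_lt_toReal (le_of_lt ht) (h0 _)]
    _ = _ := by
      have h1 : ∫⁻ t in Set.Ici (1 : ℝ), volume {x | ENNReal.ofReal t < f x} = 0 := by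
        refine setLIntegral_eq_zero measurableSet_Ici fun t ht => ?_
        have : {x | ENNReal.ofReal t < f x} = ∅ := by
          refine Set.eq_empty_of_forall_notMem fun x hx => ?_
          exact absurd (hx.trans_le (hf1 x))
            (not_lt.2 (by simpa using ENNReal.ofReal_le_ofReal ht))
        simp [this]
      rw [← Set.Ioo_union_Ici_eq_Ioi zero_lt_one, lintegral_union measurableSet_Ici, h1, add_zero]
      exact Set.disjoint_left.2 fun t ht ht' => absurd ht.2 (not_lt.2 ht')

/-- The one-dimensional inequality for functions with supremum `1`: the superlevel sets satisfy
Brunn–Minkowski, so that even `∫ f + ∫ g ≤ 2 ∫ h`. -/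
lemma lintegral_mul_le_sq_of_iSup_eq_one {f g h : ℝ → ℝ≥0∞} (hf : Measurable f)
    (hg : Measurable g) (hh : Measurable h) (hf1 : ⨆ x, f x = 1) (hg1 : ⨆ x, g x = 1)
    (H : ∀ x y, f x * g y ≤ h ((1 / 2 : ℝ) • (x + y)) ^ 2) :
    (∫⁻ x, f x) * (∫⁻ x, g x) ≤ (∫⁻ x, h x) ^ 2 := by
  -- Truncating `h` at `1` only shrinks its integral, and makes the layer-cake formula on `(0, 1)`
  -- apply to it as well.
  have hlev : ∀ t ∈ Set.Ioo (0 : ℝ) 1, volume {x | ENNReal.ofReal t < f x} +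
      volume {x | ENNReal.ofReal t < g x} ≤ 2 * volume {x | ENNReal.ofReal t < min (h x) 1} := by
    intro t ht
    have ht1 : ENNReal.ofReal t < 1 := by simpa using ht.2
    have hne : ∀ u : ℝ → ℝ≥0∞, ⨆ x, u x = 1 → {x | ENNReal.ofReal t < u x}.Nonempty := by
      intro u hu
      rw [← hu, lt_iSup_iff] at ht1
      exact ht1
    calc _ ≤ volume ((fun x : ℝ => (1 / 2 : ℝ) * x) ⁻¹' {x | ENNReal.ofReal t < min (h x) 1}) := by
          refine volume_add_le (measurableSet_lt measurable_const hf)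
            (measurableSet_lt measurable_const hg) (hne f hf1) (hne g hg1) fun x hx y hy => ?_
          refine lt_min ?_ ht1
          by_contra! hcon
          refine absurd (H x y) (not_le.2 ?_)
          calc _ ≤ ENNReal.ofReal t ^ 2 := by gcongr; exact hcon
            _ = ENNReal.ofReal t * ENNReal.ofReal t := sq _
            _ < f x * g y := ENNReal.mul_lt_mul hx hy
      _ = _ := by
          rw [Real.volume_preimage_mul_left (by norm_num)]
          norm_num
  have hsum : (∫⁻ x, f x) + (∫⁻ x, g x) ≤ 2 * ∫⁻ x, h x := by
    have hmeas : ∀ u : ℝ → ℝ≥0∞, Measurable fun t : ℝ => volume {x | ENNReal.ofReal t < u x} := by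
      intro u
      refine Antitone.measurable fun s t hst => measure_mono fun x hx => ?_
      exact (ENNReal.ofReal_le_ofReal hst).trans_lt hx
    calc _ = ∫⁻ t in Set.Ioo (0 : ℝ) 1, (volume {x | ENNReal.ofReal t < f x} +
          volume {x | ENNReal.ofReal t < g x}) := by
          rw [lintegral_eq_lintegral_Ioo_volume_lt hf fun x => hf1 ▸ le_iSup f x,
            lintegral_eq_lintegral_Ioo_volume_lt hg fun x => hg1 ▸ le_iSup g x,
            lintegral_add_left (hmeas f)]
      _ ≤ ∫⁻ t in Set.Ioo (0 : ℝ) 1, 2 * volume {x | ENNReal.ofReal t < min (h x) 1} :=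
          setLIntegral_mono' measurableSet_Ioo hlev
      _ = 2 * ∫⁻ x, min (h x) 1 := by
          rw [lintegral_const_mul _ (hmeas _),
            lintegral_eq_lintegral_Ioo_volume_lt (hh.min measurable_const) fun x => min_le_right _ _]
      _ ≤ 2 * ∫⁻ x, h x := by
          gcongr
          exact min_le_left _ _
  have h4 : 4 * ((∫⁻ x, f x) * (∫⁻ x, g x)) ≤ 4 * (∫⁻ x, h x) ^ 2 :=
    calc _ ≤ ((∫⁻ x, f x) + (∫⁻ x, g x)) ^ 2 := four_mul_le_add_sq _ _
      _ ≤ (2 * ∫⁻ x, h x) ^ 2 := by gcongr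
      _ = _ := by ring
  exact (ENNReal.mul_le_mul_iff_right (by norm_num) (by norm_num)).1 h4

/-- The one-dimensional inequality for bounded functions, by normalizing their suprema. -/
lemma lintegral_mul_le_sq_of_bounded {f g h : ℝ → ℝ≥0∞} (hf : Measurable f)
    (hg : Measurable g) (hh : Measurable h) (hf1 : ⨆ x, f x ≠ ⊤) (hg1 : ⨆ x, g x ≠ ⊤)
    (H : ∀ x y, f x * g y ≤ h ((1 / 2 : ℝ) • (x + y)) ^ 2) :
    (∫⁻ x, f x) * (∫⁻ x, g x) ≤ (∫⁻ x, h x) ^ 2 := by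
  set a := ⨆ x, f x with ha
  set b := ⨆ x, g x with hb
  by_cases ha0 : a = 0
  · have : f = 0 := by
      funext x
      exact le_zero_iff.1 ((le_iSup f x).trans ha0.le)
    simp [this]
  by_cases hb0 : b = 0
  · have : g = 0 := by
      funext x
      exact le_zero_iff.1 ((le_iSup g x).trans hb0.le)
    simp [this]
  obtain ⟨c, hc⟩ : ∃ c : ℝ≥0∞, c ^ 2 = a⁻¹ * b⁻¹ :=
    ⟨(a⁻¹ * b⁻¹) ^ (1 / 2 : ℝ), by rw [← ENNReal.rpow_natCast, ← ENNReal.rpow_mul]; norm_num⟩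
  have key := lintegral_mul_le_sq_of_iSup_eq_one (f := fun x => a⁻¹ * f x)
    (g := fun x => b⁻¹ * g x) (h := fun x => c * h x) (hf.const_mul _) (hg.const_mul _)
    (hh.const_mul _) (by rw [← ENNReal.mul_iSup, ← ha, ENNReal.inv_mul_cancel ha0 hf1])
    (by rw [← ENNReal.mul_iSup, ← hb, ENNReal.inv_mul_cancel hb0 hg1]) (fun x y => by
      calc a⁻¹ * f x * (b⁻¹ * g y) = (a⁻¹ * b⁻¹) * (f x * g y) := by ring
        _ ≤ (a⁻¹ * b⁻¹) * h ((1 / 2 : ℝ) • (x + y)) ^ 2 := by gcongr; exact H x y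
        _ = _ := by rw [mul_pow, hc])
  rw [lintegral_const_mul _ hf, lintegral_const_mul _ hg, lintegral_const_mul _ hh, mul_pow, hc,
    mul_mul_mul_comm] at key
  refine (ENNReal.mul_le_mul_iff_right ?_ ?_).1 key
  · exact mul_ne_zero (ENNReal.inv_ne_zero.2 hf1) (ENNReal.inv_ne_zero.2 hg1)
  · exact ENNReal.mul_ne_top (ENNReal.inv_ne_top.2 ha0) (ENNReal.inv_ne_top.2 hb0)

lemma lintegral_eq_iSup_lintegral_min {E : Type*} [MeasurableSpace E] {μ : Measure E}
    {f : E → ℝ≥0∞} (hf : Measurable f) :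
    ∫⁻ x, f x ∂μ = ⨆ n : ℕ, ∫⁻ x, min (f x) n ∂μ := by
  rw [← lintegral_iSup (fun n => hf.min measurable_const)
    (fun m n hmn x => min_le_min_left _ (by exact_mod_cast hmn))]
  refine lintegral_congr fun x => ?_
  rw [← inf_iSup_eq, ENNReal.iSup_natCast, inf_top_eq]

/-- Truncating `f` and `g` preserves the hypothesis, so the bounded case and monotone convergence
suffice. -/
lemma midpointPL_real : MidpointPL (volume : Measure ℝ) := by
  intro f g h hf hg hh H
  rw [lintegral_eq_iSup_lintegral_min hf, lintegral_eq_iSup_lintegral_min hg, ENNReal.iSup_mul]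
  refine iSup_le fun m => ?_
  rw [ENNReal.mul_iSup]
  refine iSup_le fun n => ?_
  have hb : ∀ (u : ℝ → ℝ≥0∞) (n : ℕ), ⨆ x, min (u x) n ≠ ⊤ := fun u n =>
    ne_top_of_le_ne_top (ENNReal.natCast_ne_top n) (iSup_le fun x => min_le_right _ _)
  exact lintegral_mul_le_sq_of_bounded (hf.min measurable_const) (hg.min measurable_const) hh
    (hb f m) (hb g n) fun x y =>
      (mul_le_mul' (min_le_left _ _) (min_le_left _ _)).trans (H x y)

/-- Tonelli: the inequality on each pair of fibres is the hypothesis on the base. -/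
lemma MidpointPL.prod {E F : Type*} [AddCommGroup E] [Module ℝ E] [MeasurableSpace E]
    [AddCommGroup F] [Module ℝ F] [MeasurableSpace F] {μ : Measure E} {ν : Measure F}
    [SFinite ν] (hμ : MidpointPL μ) (hν : MidpointPL ν) : MidpointPL (μ.prod ν) := by
  intro f g h hf hg hh H
  rw [lintegral_prod _ hf.aemeasurable, lintegral_prod _ hg.aemeasurable,
    lintegral_prod _ hh.aemeasurable]
  refine hμ _ _ _ hf.lintegral_prod_right' hg.lintegral_prod_right' hh.lintegral_prod_right'
    fun x y => ?_
  exact hν _ _ _ (hf.comp measurable_prodMk_left) (hg.comp measurable_prodMk_left)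
    (hh.comp measurable_prodMk_left) fun u v => H (x, u) (y, v)

lemma MidpointPL.of_measurePreserving {E F : Type*} [AddCommGroup E] [Module ℝ E]
    [MeasurableSpace E] [AddCommGroup F] [Module ℝ F] [MeasurableSpace F] {μ : Measure E}
    {ν : Measure F} (hμ : MidpointPL μ) (e : E →ₗ[ℝ] F) (he : MeasurePreserving e μ ν) :
    MidpointPL ν := by
  intro f g h hf hg hh H
  rw [← he.lintegral_comp hf, ← he.lintegral_comp hg, ← he.lintegral_comp hh]
  refine hμ _ _ _ (hf.comp he.measurable) (hg.comp he.measurable) (hh.comp he.measurable)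
    fun x y => ?_
  simpa using H (e x) (e y)

lemma midpointPL_pi (n : ℕ) : MidpointPL (volume : Measure (Fin n → ℝ)) := by
  induction n with
  | zero =>
    intro f g h _ _ _ H
    rw [volume_pi, Measure.pi_of_empty (x := 0)]
    have := H 0 0
    simpa using this
  | succ n ih =>
    refine (midpointPL_real.prod ih).of_measurePreserving
      (LinearEquiv.toLinearMap (Fin.consLinearEquiv ℝ (fun _ : Fin (n + 1) => ℝ))) ?_
    convert! (volume_preserving_piFinSuccAbove (fun _ : Fin (n + 1) => ℝ) 0).symm using 1
    ext p i
    refine Fin.cases ?_ (fun j => ?_) i <;> simp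

lemma midpointPL_volume {E : Type*} [NormedAddCommGroup E] [InnerProductSpace ℝ E]
    [FiniteDimensional ℝ E] [MeasurableSpace E] [BorelSpace E] :
    MidpointPL (volume : Measure E) := by
  have h1 := (midpointPL_pi (Module.finrank ℝ E)).of_measurePreserving
    (WithLp.linearEquiv 2 ℝ (Fin (Module.finrank ℝ E) → ℝ)).symm.toLinearMap
    (PiLp.volume_preserving_toLp _)
  exact h1.of_measurePreserving (stdOrthonormalBasis ℝ E).repr.symm.toLinearEquiv.toLinearMap
    (stdOrthonormalBasis ℝ E).measurePreserving_repr_symm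

/-! ### The isodiametric inequality -/

/-- The isodiametric inequality. It is the midpoint Prékopa–Leindler inequality for the indicators of
the closure `K` of `s`, of `-K`, and of the ball, which contains `(K - K) / 2`. -/
theorem volume_le_volume_closedBall_of_dist_le {E : Type*} [NormedAddCommGroup E]
    [InnerProductSpace ℝ E] [FiniteDimensional ℝ E] [MeasurableSpace E] [BorelSpace E]
    {s : Set E} {d : ℝ} (hs : ∀ x ∈ s, ∀ y ∈ s, dist x y ≤ d) :
    volume s ≤ volume (Metric.closedBall (0 : E) (d / 2)) := by
  have hcl : ∀ x ∈ closure s, ∀ y ∈ closure s, dist x y ≤ d := by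
    intro x hx y hy
    have hsub : s ×ˢ s ⊆ {p : E × E | dist p.1 p.2 ≤ d} := fun p hp => hs _ hp.1 _ hp.2
    have hmem : (x, y) ∈ closure (s ×ˢ s) := by
      rw [closure_prod_eq]
      exact ⟨hx, hy⟩
    exact closure_minimal hsub (isClosed_le (by fun_prop) continuous_const) hmem
  have hK : MeasurableSet (closure s) := isClosed_closure.measurableSet
  have key := midpointPL_volume (E := E) ((closure s).indicator 1) ((-closure s).indicator 1)
    ((Metric.closedBall (0 : E) (d / 2)).indicator 1) (measurable_one.indicator hK)
    (measurable_one.indicator hK.neg) (measurable_one.indicator measurableSet_closedBall) ?_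
  · rw [lintegral_indicator_one hK, lintegral_indicator_one hK.neg,
      lintegral_indicator_one measurableSet_closedBall, Measure.measure_neg, ← sq] at key
    exact (measure_mono subset_closure).trans ((ENNReal.pow_le_pow_left_iff two_ne_zero).1 key)
  · intro x y
    by_cases hx : x ∈ closure s
    · by_cases hy : y ∈ -closure s
      · have : (1 / 2 : ℝ) • (x + y) ∈ Metric.closedBall (0 : E) (d / 2) := by
          have h1 := hcl x hx (-y) hy
          rw [dist_eq_norm, sub_neg_eq_add] at h1
          rw [mem_closedBall_zero_iff, norm_smul]
          norm_num
          linarith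
        rw [Set.indicator_of_mem hx, Set.indicator_of_mem hy, Set.indicator_of_mem this]
        simp
      · simp [hy]
    · simp [hx]

/-! ### Logarithmic asymptotics of the Gamma function -/

/-- Lower Stirling bound: integrate `e^{-t} t^x ≥ e^{-t} x^x` over `t > x`. -/
lemma le_log_Gamma_add_one {x : ℝ} (hx : 0 < x) :
    x * Real.log x - x ≤ Real.log (Real.Gamma (x + 1)) := by
  have hG : Real.Gamma (x + 1) = ∫ t in Set.Ioi (0 : ℝ), Real.exp (-t) * t ^ x := by
    rw [Real.Gamma_eq_integral (by linarith)]
    simp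
  have hint : IntegrableOn (fun t : ℝ => Real.exp (-t) * t ^ x) (Set.Ioi 0) := by
    simpa using Real.GammaIntegral_convergent (s := x + 1) (by linarith)
  rw [Real.le_log_iff_exp_le (Real.Gamma_pos_of_pos (by linarith)), hG]
  calc Real.exp (x * Real.log x - x) = ∫ t in Set.Ioi x, Real.exp (-t) * x ^ x := by
        rw [integral_mul_const, integral_exp_neg_Ioi, Real.rpow_def_of_pos hx, ← Real.exp_add]
        congr 1
        ring
    _ ≤ ∫ t in Set.Ioi x, Real.exp (-t) * t ^ x := by
        refine setIntegral_mono_on ((integrableOn_exp_neg_Ioi x).mul_const _)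
          (hint.mono_set (Set.Ioi_subset_Ioi hx.le)) measurableSet_Ioi fun t ht => ?_
        have : x ≤ t := le_of_lt ht
        gcongr
    _ ≤ _ := by
        refine setIntegral_mono_set hint ?_ (Set.Ioi_subset_Ioi hx.le).eventuallyLE
        filter_upwards [ae_restrict_mem measurableSet_Ioi] with t ht
        have : 0 < t := ht
        positivity

/-- Upper Stirling bound: with `l = x / (x + 1)`, the maximum of `e^{-l t} t^x` is `(x + 1)^x e^{-x}`,
and the remaining factor `e^{-t / (x + 1)}` has integral `x + 1`. -/
lemma log_Gamma_add_one_le {x : ℝ} (hx : 0 < x) :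
    Real.log (Real.Gamma (x + 1)) ≤ x * Real.log (x + 1) - x + Real.log (x + 1) := by
  have hG : Real.Gamma (x + 1) = ∫ t in Set.Ioi (0 : ℝ), Real.exp (-t) * t ^ x := by
    rw [Real.Gamma_eq_integral (by linarith)]
    simp
  have hint : IntegrableOn (fun t : ℝ => Real.exp (-t) * t ^ x) (Set.Ioi 0) := by
    simpa using Real.GammaIntegral_convergent (s := x + 1) (by linarith)
  have hx1 : 0 < x + 1 := by linarith
  have hneg : -(x + 1)⁻¹ < 0 := by
    have := inv_pos.2 hx1
    linarith
  rw [Real.log_le_iff_le_exp (Real.Gamma_pos_of_pos hx1), hG]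
  calc ∫ t in Set.Ioi (0 : ℝ), Real.exp (-t) * t ^ x
      ≤ ∫ t in Set.Ioi (0 : ℝ),
          Real.exp (x * Real.log (x + 1) - x) * Real.exp (-(x + 1)⁻¹ * t) := by
        refine setIntegral_mono_on hint ((integrableOn_exp_mul_Ioi hneg 0).const_mul _)
          measurableSet_Ioi fun t ht => ?_
        have ht : 0 < t := ht
        rw [Real.rpow_def_of_pos ht, ← Real.exp_add, ← Real.exp_add]
        refine Real.exp_le_exp.2 ?_
        have h1 := Real.log_le_sub_one_of_pos (div_pos ht hx1)
        rw [Real.log_div ht.ne' hx1.ne'] at h1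
        have h2 := mul_le_mul_of_nonneg_left h1 hx.le
        have h3 : x * (t / (x + 1) - 1) = t - (x + 1)⁻¹ * t - x := by
          field_simp
          ring
        nlinarith
    _ = Real.exp (x * Real.log (x + 1) - x) * (x + 1) := by
        rw [integral_const_mul, integral_exp_mul_Ioi hneg]
        simp
    _ = _ := by
        rw [Real.exp_add, Real.exp_log hx1]

lemma tendsto_log_Gamma_add_one_div_sub_log :
    Tendsto (fun x : ℝ => Real.log (Real.Gamma (x + 1)) / x - Real.log x) atTop (𝓝 (-1)) := by
  have h1 : Tendsto (fun x : ℝ => Real.log (x + 1) - Real.log x) atTop (𝓝 0) := by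
    exact Real.tendsto_log_comp_add_sub_log 1
  have h2 : Tendsto (fun x : ℝ => Real.log x / x) atTop (𝓝 0) := by
    simpa using Real.isLittleO_log_id_atTop.tendsto_div_nhds_zero
  have h3 : Tendsto (fun x : ℝ => (Real.log (x + 1) - Real.log x) + -1 +
      ((Real.log (x + 1) - Real.log x) * x⁻¹ + Real.log x / x)) atTop (𝓝 (-1)) := by
    simpa using (h1.add_const (-1)).add ((h1.mul tendsto_inv_atTop_zero).add h2)
  refine tendsto_of_tendsto_of_tendsto_of_le_of_le' tendsto_const_nhds h3 ?_ ?_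
  · filter_upwards [eventually_gt_atTop 0] with x hx
    have h := div_le_div_of_nonneg_right (le_log_Gamma_add_one hx) hx.le
    have e : (x * Real.log x - x) / x = Real.log x - 1 := by field_simp
    linarith
  · filter_upwards [eventually_gt_atTop 0] with x hx
    have h := div_le_div_of_nonneg_right (log_Gamma_add_one_le hx) hx.le
    have e : (x * Real.log (x + 1) - x + Real.log (x + 1)) / x =
      Real.log (x + 1) - 1 + Real.log (x + 1) * x⁻¹ := by field_simp
    have e2 : Real.log x / x = Real.log x * x⁻¹ := div_eq_mul_inv _ _
    rw [e2, sub_mul]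
    linarith

/-! ### Hausdorff premeasures in top dimension are Lebesgue measure -/

/-- Rank–nullity for the imaginary part, which maps the `2 k²`-dimensional space of all matrices onto
the self-adjoint ones with kernel the self-adjoint ones. -/
lemma finrank_selfAdjoint_matrix (k : ℕ) :
    Module.finrank ℝ (selfAdjoint (Matrix (Fin k) (Fin k) ℂ)) = k ^ 2 := by
  have h := (imaginaryPart (A := Matrix (Fin k) (Fin k) ℂ)).finrank_range_add_finrank_ker
  rw [LinearMap.range_eq_top.2 imaginaryPart_surjective, finrank_top, ker_imaginaryPart,
    Module.finrank_matrix, Complex.finrank_real_complex, Fintype.card_fin] at h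
  have h2 : Module.finrank ℝ (selfAdjoint.submodule ℝ (Matrix (Fin k) (Fin k) ℂ)) =
    Module.finrank ℝ (selfAdjoint (Matrix (Fin k) (Fin k) ℂ)) := rfl
  rw [h2] at h
  linarith [sq k]

lemma finrank_SATuple (n k : ℕ) : Module.finrank ℝ (SATuple n k) = n * k ^ 2 := by
  have h : Module.finrank ℝ (Fin n → selfAdjoint (Matrix (Fin k) (Fin k) ℂ)) = n * k ^ 2 := by
    have : FiniteDimensional ℝ (selfAdjoint (Matrix (Fin k) (Fin k) ℂ)) :=
      inferInstanceAs
        (FiniteDimensional ℝ (selfAdjoint.submodule ℝ (Matrix (Fin k) (Fin k) ℂ)))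
    rw [Module.finrank_pi_fintype]
    simp [finrank_selfAdjoint_matrix]
  exact h

/-- In a Euclidean space of dimension `N ≥ 1`, with distances divided by `a`, the Hausdorff premeasure
`H^N_ε` is a multiple of Lebesgue measure, whatever `ε > 0`. One inequality is the isodiametric
inequality for each set of a cover; the other is the Vitali–Besicovitch covering of `S` by balls of
small radius whose measures add up to little more than that of `S`. -/
theorem volume_closedBall_mul_hausdorffPre {E : Type*} [NormedAddCommGroup E]
    [InnerProductSpace ℝ E] [FiniteDimensional ℝ E] [MeasurableSpace E] [BorelSpace E]
    [Nontrivial E] {a ε : ℝ} (ha : 0 < a) (hε : 0 < ε) (S : Set E) :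
    volume (Metric.closedBall (0 : E) (a / 2)) *
      hausdorffPre (fun x y : E => dist x y / a) (Module.finrank ℝ E) ε S = volume S := by
  set N := Module.finrank ℝ E with hN
  have hN0 : N ≠ 0 := (Module.finrank_pos (R := ℝ) (M := E)).ne'
  set d : E → E → ℝ := fun x y => dist x y / a with hd
  have hball : ∀ (x : E) (r : ℝ), 0 ≤ r → volume (Metric.closedBall x (a * r / 2)) =
      volume (Metric.closedBall (0 : E) (a / 2)) * ENNReal.ofReal r ^ N := by
    intro x r hr
    rw [mul_div_right_comm, mul_comm, Measure.addHaar_closedBall_mul _ _ hr (by positivity),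
      ENNReal.ofReal_pow hr, mul_comm]
  have hc0 : volume (Metric.closedBall (0 : E) (a / 2)) ≠ 0 :=
    (Metric.measure_closedBall_pos _ _ (by positivity)).ne'
  have hct : volume (Metric.closedBall (0 : E) (a / 2)) ≠ ⊤ := measure_closedBall_lt_top.ne
  apply le_antisymm
  · refine ENNReal.le_of_forall_pos_le_add fun δ hδ _ => ?_
    obtain ⟨t, r, htc, -, hr, hcov, hsum⟩ := Besicovitch.exists_closedBall_covering_tsum_measure_le
      (volume : Measure E) (ε := δ) (by exact_mod_cast hδ.ne') (fun _ => Set.Ioc 0 (a * ε / 2)) S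
      (fun x _ η hη => ⟨min (η / 2) (a * ε / 2), ⟨by positivity, min_le_right _ _⟩, by positivity,
        (min_le_left _ _).trans_lt (by linarith)⟩)
    have : Encodable t := htc.toEncodable
    have hdiam : ∀ x : t, diamWith d (Metric.closedBall (x : E) (r x)) ≤
        ENNReal.ofReal (2 * r x / a) := by
      intro x
      refine iSup₂_le fun y hy => iSup₂_le fun w hw => ENNReal.ofReal_le_ofReal ?_
      have h1 := dist_triangle_right y w (x : E)
      rw [Metric.mem_closedBall] at hy hw
      simp only [hd]
      gcongr
      linarith
    -- The balls, enumerated by `ℕ` with empty sets as padding; these contribute `0 ^ N = 0`.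
    set θ : ℕ → Set E := fun j => ⋃ b ∈ Encodable.decode₂ t j, Metric.closedBall (b : E) (r b)
      with hθ
    have hempty : diamWith d (∅ : Set E) = 0 := by simp [diamWith]
    have hH : hausdorffPre d N ε S ≤ ∑' j, diamWith d (θ j) ^ (N : ℝ) := by
      refine iInf_le_of_le θ (iInf_le_of_le ?_ (iInf_le_of_le (fun j => ?_) le_rfl))
      · rw [hθ, Encodable.iUnion_decode₂]
        simpa only [Set.iUnion_coe_set] using hcov
      · refine Encodable.iUnion_decode₂_cases (C := fun s => diamWith d s ≤ ENNReal.ofReal ε)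
          (by simp [hempty]) fun x => (hdiam x).trans (ENNReal.ofReal_le_ofReal ?_)
        rw [div_le_iff₀ ha]
        have := (hr x x.2).2
        linarith
    calc _ ≤ volume (Metric.closedBall (0 : E) (a / 2)) * ∑' j, diamWith d (θ j) ^ (N : ℝ) := by
          gcongr
      _ = volume (Metric.closedBall (0 : E) (a / 2)) *
          ∑' x : t, diamWith d (Metric.closedBall (x : E) (r x)) ^ (N : ℝ) := by
          rw [hθ, tsum_iUnion_decode₂ (fun s => diamWith d s ^ (N : ℝ)) (by simp [hempty, hN0])]
      _ = ∑' x : t, volume (Metric.closedBall (0 : E) (a / 2)) *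
          diamWith d (Metric.closedBall (x : E) (r x)) ^ (N : ℝ) := ENNReal.tsum_mul_left.symm
      _ ≤ ∑' x : t, volume (Metric.closedBall (x : E) (r x)) := by
          refine ENNReal.tsum_le_tsum fun x => ?_
          have h0 : 0 < r x := (hr x x.2).1
          have h1 : r x = a * (2 * r x / a) / 2 := by field_simp
          rw [h1, hball _ _ (by positivity), ENNReal.rpow_natCast, ← h1]
          gcongr
          exact hdiam x
      _ ≤ _ := hsum
  · rw [← ENNReal.div_le_iff' hc0 hct]
    refine le_iInf fun θ => le_iInf fun hcov => le_iInf fun hdiam => ?_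
    rw [ENNReal.div_le_iff' hc0 hct, ← ENNReal.tsum_mul_left]
    refine ((measure_mono hcov).trans (measure_iUnion_le _)).trans
      (ENNReal.tsum_le_tsum fun j => ?_)
    have hfin : diamWith d (θ j) ≠ ⊤ := ne_top_of_le_ne_top ENNReal.ofReal_ne_top (hdiam j)
    have hdist : ∀ x ∈ θ j, ∀ y ∈ θ j, dist x y ≤ a * (diamWith d (θ j)).toReal := by
      intro x hx y hy
      have h1 : ENNReal.ofReal (d x y) ≤ diamWith d (θ j) :=
        le_iSup₂_of_le x hx (le_iSup₂_of_le y hy le_rfl)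
      rw [ENNReal.ofReal_le_iff_le_toReal hfin] at h1
      simp only [hd] at h1
      rwa [div_le_iff₀' ha] at h1
    refine (volume_le_volume_closedBall_of_dist_le hdist).trans ?_
    rw [hball _ _ ENNReal.toReal_nonneg, ENNReal.ofReal_toReal hfin, ENNReal.rpow_natCast]

lemma SATuple.dist₂_eq {n k : ℕ} :
    (SATuple.dist₂ : SATuple n k → SATuple n k → ℝ) = fun x y => dist x y / √k := by
  funext x y
  rw [SATuple.dist₂, SATuple.norm₂_eq, dist_eq_norm]

/-- The logarithm of the volume of a ball of radius `1 / 2` for `|·|₂`, that is, of a Euclidean ball of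
radius `√k / 2` in dimension `n * k ^ 2`. -/
noncomputable def logBallVolume (n k : ℕ) : ℝ :=
  (n * k ^ 2 : ℝ) * Real.log (√k / 2) + (n * k ^ 2 : ℝ) * Real.log √Real.pi -
    Real.log (Real.Gamma ((n * k ^ 2 : ℝ) / 2 + 1))

lemma log_volume_eq {n k : ℕ} (hn : 1 ≤ n) (hk : 1 ≤ k) {ε : ℝ} (hε : 0 < ε)
    (S : Set (SATuple n k)) :
    ENNReal.log (volume S) = (logBallVolume n k : EReal) +
      ENNReal.log (hausdorffPre SATuple.dist₂ ((n : ℝ) * (k : ℝ) ^ 2) ε S) := by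
  have hpos : 0 < n * k ^ 2 := by positivity
  have : Nontrivial (SATuple n k) :=
    Module.nontrivial_of_finrank_pos (R := ℝ) (by rw [finrank_SATuple]; exact hpos)
  have hsk : 0 < √(k : ℝ) := by positivity
  have hG : 0 < Real.Gamma ((n * k ^ 2 : ℝ) / 2 + 1) := Real.Gamma_pos_of_pos (by positivity)
  have h := volume_closedBall_mul_hausdorffPre hsk hε S
  rw [← SATuple.dist₂_eq, finrank_SATuple] at h
  have e : (((n * k ^ 2 : ℕ)) : ℝ) = (n : ℝ) * (k : ℝ) ^ 2 := by push_cast; rfl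
  rw [← h, ENNReal.log_mul_add, InnerProductSpace.volume_closedBall, finrank_SATuple, e,
    ← ENNReal.ofReal_pow (by positivity), ← ENNReal.ofReal_mul (by positivity),
    ENNReal.log_ofReal_of_pos (by positivity), logBallVolume, Real.log_mul (by positivity)
    (by positivity), Real.log_div (by positivity) hG.ne', Real.log_pow, Real.log_pow, e,
    add_sub_assoc]

lemma tendsto_logBallVolume {n : ℕ} (hn : 1 ≤ n) :
    Tendsto (fun k : ℕ => ((k : ℝ) ^ 2)⁻¹ * logBallVolume n k + (n : ℝ) / 2 * Real.log k) atTop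
      (𝓝 (-((n : ℝ) / 2 * Real.log (2 * (n : ℝ) / (Real.pi * Real.exp 1))))) := by
  have hn0 : (0 : ℝ) < n := by positivity
  have hx : Tendsto (fun k : ℕ => (n * k ^ 2 : ℝ) / 2) atTop atTop :=
    (((tendsto_pow_atTop two_ne_zero).comp tendsto_natCast_atTop_atTop).const_mul_atTop
      hn0).atTop_div_const two_pos
  have h := ((tendsto_log_Gamma_add_one_div_sub_log.comp hx).const_mul (-(n / 2 : ℝ))).add_const
    (n / 2 * (Real.log Real.pi - Real.log 2 - Real.log n))
  have hlim : -(n / 2 : ℝ) * -1 + n / 2 * (Real.log Real.pi - Real.log 2 - Real.log n) =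
      -((n : ℝ) / 2 * Real.log (2 * (n : ℝ) / (Real.pi * Real.exp 1))) := by
    rw [Real.log_div (by positivity) (by positivity), Real.log_mul (by positivity) (by positivity),
      Real.log_mul (by positivity) (by positivity), Real.log_exp]
    ring
  rw [hlim] at h
  refine h.congr' ?_
  filter_upwards [eventually_ge_atTop 1] with k hk
  have hk0 : (0 : ℝ) < k := by positivity
  simp only [Function.comp_apply, logBallVolume]
  rw [Real.log_div (by positivity : √(k : ℝ) ≠ 0) two_ne_zero, Real.log_sqrt hk0.le,
    Real.log_sqrt Real.pi_pos.le, Real.log_div (by positivity : (n * k ^ 2 : ℝ) ≠ 0) two_ne_zero,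
    Real.log_mul hn0.ne' (by positivity), Real.log_pow]
  field_simp
  push_cast
  ring

/-! ### Passing to the limit -/

lemma limsup_add_coe_of_tendsto {u : ℕ → EReal} {b : ℕ → ℝ} {c : ℝ}
    (hb : Tendsto b atTop (𝓝 c)) :
    limsup (fun k => u k + (b k : EReal)) atTop = limsup u atTop + c := by
  have hb' : Tendsto (fun k => (b k : EReal)) atTop (𝓝 (c : EReal)) := EReal.tendsto_coe.2 hb
  apply le_antisymm
  · rw [← hb'.limsup_eq]
    exact EReal.limsup_add_le (Or.inr (by rw [hb'.limsup_eq]; exact EReal.coe_ne_top c))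
      (Or.inr (by rw [hb'.limsup_eq]; exact EReal.coe_ne_bot c))
  · rw [← hb'.liminf_eq]
    exact EReal.le_limsup_add

/-- Translation by a real number, as an order automorphism of the extended reals. -/
noncomputable def addCoeOrderIso (c : ℝ) : EReal ≃o EReal where
  toFun x := x + c
  invFun x := x - c
  left_inv x := EReal.add_sub_cancel_right
  right_inv x := EReal.sub_add_cancel
  map_rel_iff' := by
    intro x y
    refine ⟨fun h => ?_, fun h => add_le_add_left h _⟩
    have := EReal.sub_le_sub h (le_refl (c : EReal))
    simpa [EReal.add_sub_cancel_right] using this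

section

variable {A : Type*} [Ring A] [Algebra ℂ A] {n : ℕ}

lemma chiRmγ_eq (hn : 1 ≤ n) (φ : A →ₗ[ℂ] ℂ) (z : Fin n → A) {ε : ℝ} (hε : 0 < ε) (R : ℝ)
    (m : ℕ) (γ : ℝ) :
    chiRmγ φ z R m γ = hausEntεRmγ φ z n ε R m γ +
      ((-((n : ℝ) / 2 * Real.log (2 * (n : ℝ) / (Real.pi * Real.exp 1))) : ℝ) : EReal) := by
  rw [hausEntεRmγ, ← limsup_add_coe_of_tendsto (tendsto_logBallVolume hn), chiRmγ]
  refine limsup_congr ?_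
  filter_upwards [eventually_ge_atTop 1] with k hk
  have h0 : (0 : EReal) ≤ ((((k : ℝ) ^ 2)⁻¹ : ℝ) : EReal) := by
    exact_mod_cast (by positivity : (0 : ℝ) ≤ ((k : ℝ) ^ 2)⁻¹)
  rw [log_volume_eq hn hk hε, EReal.left_distrib_of_nonneg_of_ne_top h0 (EReal.coe_ne_top _),
    EReal.coe_add, EReal.coe_mul (((k : ℝ) ^ 2)⁻¹)]
  abel

lemma hausEntεR_eq (hn : 1 ≤ n) (φ : A →ₗ[ℂ] ℂ) (z : Fin n → A) {ε : ℝ} (hε : 0 < ε) (R : ℝ) :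
    hausEntεR φ z n ε R = addCoeOrderIso
      ((n : ℝ) / 2 * Real.log (2 * (n : ℝ) / (Real.pi * Real.exp 1))) (chiR φ z R) := by
  simp only [hausEntεR, chiR, OrderIso.map_iInf]
  refine iInf_congr fun m => iInf_congr fun γ => iInf_congr fun _ => ?_
  rw [chiRmγ_eq hn φ z hε, EReal.coe_neg, ← sub_eq_add_neg]
  exact EReal.sub_add_cancel.symm

lemma hausEntR_eq (hn : 1 ≤ n) (φ : A →ₗ[ℂ] ℂ) (z : Fin n → A) (R : ℝ) :
    hausEntR φ z n R = addCoeOrderIso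
      ((n : ℝ) / 2 * Real.log (2 * (n : ℝ) / (Real.pi * Real.exp 1))) (chiR φ z R) := by
  refine tendsto_nhds_unique (tendsto_hausEntεR φ z n R) (tendsto_const_nhds.congr' ?_)
  filter_upwards [self_mem_nhdsWithin] with ε hε
  exact (hausEntεR_eq hn φ z hε R).symm

end

end FreeHausdorff

theorem lemma3p7 {H : Type*} [NormedAddCommGroup H] [InnerProductSpace ℂ H] [CompleteSpace H]
    (M : VonNeumannAlgebra H) (φ : M.toStarSubalgebra →ₗ[ℂ] ℂ)
    (hφ : FreeHausdorff.IsNormalTracialState M φ)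
    (n : ℕ) (hn : 1 ≤ n) (z : Fin n → M.toStarSubalgebra) (hz : ∀ i, IsSelfAdjoint (z i)) :
    FreeHausdorff.hausEnt φ z (n : ℝ) =
      FreeHausdorff.chi φ z +
        (((n : ℝ) / 2 * Real.log (2 * (n : ℝ) / (Real.pi * Real.exp 1)) : ℝ) : EReal) := by
  change _ = FreeHausdorff.addCoeOrderIso _ (FreeHausdorff.chi φ z)
  simp only [FreeHausdorff.hausEnt, FreeHausdorff.chi, OrderIso.map_iSup]
  exact iSup_congr fun R => iSup_congr fun _ => FreeHausdorff.hausEntR_eq hn φ z R
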